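/- For an odd integer $n>1$ and integers $c,d$, let $(c,d)_n$ denote the determinant of the $(n-1)\times(n-1)$ matrix $\left[\left(\frac{i^2+cij+dj^2}{n}\right)\right]_{1\le i,j\le n-1}$ and let $[c,d]_n$ denote the determinant of the $n\times n$ matrix $\left[\left(\frac{i^2+cij+dj^2}{n}\right)\right]_{0\le i,j\le n-1}$, where $\left(\frac{\cdot}{n}\right)$ is the Jacobi symbol. Then for every positive integer $n\equiv 3\pmod 4$, $$(6,1)_n=[6,1]_n=(3,2)_n=[3,2]_n=0$$ and $$(4,2)_n=(8,8)_n=(3,3)_n=(21,112)_n=0.$$ -/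

import Mathlib

/-- The determinant `(c, d)_n` of the matrix of Jacobi symbols
`((i ^ 2 + c * i * j + d * j ^ 2) / n)`, with `i` and `j` running over `1, …, n - 1`.
The row index `i : Fin (n - 1)` stands for the integer `i + 1`, and likewise for columns. -/
def sunDet (c d : ℤ) (n : ℕ) : ℤ :=
  Matrix.det (Matrix.of fun i j : Fin (n - 1) =>
    jacobiSym (((i : ℕ) + 1 : ℤ) ^ 2 + c * ((i : ℕ) + 1 : ℤ) * ((j : ℕ) + 1 : ℤ)
      + d * ((j : ℕ) + 1 : ℤ) ^ 2) n)

/-- The determinant `[c, d]_n` of the matrix of Jacobi symbols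
`((i ^ 2 + c * i * j + d * j ^ 2) / n)`, with `i` and `j` running over `0, …, n - 1`. -/
def sunDetZero (c d : ℤ) (n : ℕ) : ℤ :=
  Matrix.det (Matrix.of fun i j : Fin n =>
    jacobiSym (((i : ℕ) : ℤ) ^ 2 + c * ((i : ℕ) : ℤ) * ((j : ℕ) : ℤ)
      + d * ((j : ℕ) : ℤ) ^ 2) n)

/-! Each determinant vanishes because its matrix kills a nonzero vector, and such a vector comes
from a single prime. If n ≡ 3 mod 4, some prime p ≡ 3 mod 4 divides n; write n = p * m. If p ∣ m,
two columns of the matrix coincide. Otherwise the Chinese remainder theorem makes the full matrix a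
tensor product, and a null vector modulo p extends to one modulo n.

Modulo p, with χ the quadratic character, there are two sources of null vectors. If χ(d) = -1, an
inversion of the column index makes the row sums over nonzero j vanish for every i ≠ 0. If S(c, d) =
∑ χ(x (x² + c x + d)) is zero, then χ itself is a null vector of the full matrix.

The sums S vanish because the curves y² = x (x² + c x + d) have complex multiplication: by √-1 for
(3, 2), whose 2-isogenous curve gives (6, 1), by √-2 for (4, 2) and its twist (8, 8), by √-3 for (3,
3), and by (1 + √-7)/2 for (21, 112). In the last case the isogeny is defined over an extension of
the prime field, so S is replaced by its residue modulo p, the Hasse invariant, which makes sense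
over any field of characteristic p. -/

/-- The Jacobi symbol modulo `n` as a function on `ZMod n`. -/
def zmodJacobi (n : ℕ) (a : ZMod n) : ℤ := jacobiSym a.cast n

theorem zmodJacobi_intCast (n : ℕ) (a : ℤ) : zmodJacobi n (a : ZMod n) = jacobiSym a n := by
  rw [zmodJacobi, ZMod.coe_intCast, ← jacobiSym.mod_left]

theorem zmodJacobi_mul {p m : ℕ} [NeZero p] [NeZero m] (x : ZMod (p * m)) :
    zmodJacobi (p * m) x =
      zmodJacobi p (ZMod.castHom (dvd_mul_right p m) (ZMod p) x) *
        zmodJacobi m (ZMod.castHom (dvd_mul_left m p) (ZMod m) x) := by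
  obtain ⟨a, rfl⟩ := ZMod.intCast_surjective x
  simp only [map_intCast, zmodJacobi_intCast]
  exact jacobiSym.mul_right a p m

theorem zmodJacobi_prime (p : ℕ) [Fact p.Prime] (a : ZMod p) :
    zmodJacobi p a = quadraticChar (ZMod p) a := by
  obtain ⟨a, rfl⟩ := ZMod.intCast_surjective a
  rw [zmodJacobi_intCast, ← jacobiSym.legendreSym.to_jacobiSym]
  rfl

/-! ### Null vectors and determinants -/

/-- The entry of the Jacobi symbol matrix of `x ^ 2 + c * x * y + d * y ^ 2` modulo `n`. -/
def formJacobi (c d : ℤ) (n : ℕ) (i j : ZMod n) : ℤ :=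
  zmodJacobi n (i ^ 2 + c * i * j + d * j ^ 2)

/-- There is a nonzero kernel vector of the full Jacobi symbol matrix which vanishes at `0`. -/
def HasNullVector (c d : ℤ) (n : ℕ) [NeZero n] : Prop :=
  ∃ v : ZMod n → ℤ, v ≠ 0 ∧ v 0 = 0 ∧ ∀ i, ∑ j, formJacobi c d n i j * v j = 0

/-- There is a nonzero kernel vector of the Jacobi symbol matrix with the indices `0` removed. -/
def HasMinorNullVector (c d : ℤ) (n : ℕ) [NeZero n] : Prop :=
  ∃ v : ZMod n → ℤ, v ≠ 0 ∧ v 0 = 0 ∧ ∀ i, i ≠ 0 → ∑ j, formJacobi c d n i j * v j = 0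

theorem HasNullVector.minor {c d : ℤ} {n : ℕ} [NeZero n] (h : HasNullVector c d n) :
    HasMinorNullVector c d n := by
  obtain ⟨v, h1, h2, h3⟩ := h
  exact ⟨v, h1, h2, fun i _ => h3 i⟩

theorem formJacobi_val (c d : ℤ) (n : ℕ) [NeZero n] (i j : ZMod n) :
    formJacobi c d n i j =
      jacobiSym ((i.val : ℤ) ^ 2 + c * (i.val : ℤ) * (j.val : ℤ) + d * (j.val : ℤ) ^ 2) n := by
  rw [formJacobi, ← zmodJacobi_intCast]
  push_cast
  simp only [ZMod.natCast_zmod_val]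

theorem HasNullVector.sunDetZero_eq_zero {c d : ℤ} {n : ℕ} [NeZero n] (h : HasNullVector c d n) :
    sunDetZero c d n = 0 := by
  obtain ⟨k, rfl⟩ := Nat.exists_eq_succ_of_ne_zero (NeZero.ne n)
  obtain ⟨v, h1, -, h3⟩ := h
  refine Matrix.exists_mulVec_eq_zero_iff.mp ⟨v, h1, funext fun i => Eq.trans ?_ (h3 i)⟩
  change ∑ j : Fin (k + 1), _ = ∑ j : Fin (k + 1), _
  exact Finset.sum_congr rfl fun j _ => congrArg (· * v j) (formJacobi_val c d (k + 1) i j).symm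

theorem HasMinorNullVector.sunDet_eq_zero {c d : ℤ} {n : ℕ} [NeZero n]
    (h : HasMinorNullVector c d n) : sunDet c d n = 0 := by
  obtain ⟨k, rfl⟩ := Nat.exists_eq_succ_of_ne_zero (NeZero.ne n)
  obtain ⟨v, h1, h2, h3⟩ := h
  let w : Fin k → ℤ := fun j => v (Fin.succ j)
  have hw : w ≠ 0 := by
    intro hw
    apply h1
    funext j
    exact Fin.cases (motive := fun j => v j = 0) h2 (fun j => congrFun hw j) j
  refine Matrix.exists_mulVec_eq_zero_iff.mp ⟨w, hw, funext fun i => Eq.trans ?_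
    (h3 (Fin.succ i) (Fin.succ_ne_zero i))⟩
  have h20 : v (0 : Fin (k + 1)) = 0 := h2
  refine Eq.trans ?_ (Fin.sum_univ_succ (n := k)
    (fun j => formJacobi c d (k + 1) (Fin.succ i) j * v j)).symm
  rw [h20, mul_zero, zero_add]
  change ∑ j : Fin k, _ = _
  refine Finset.sum_congr rfl fun j _ => congrArg (· * w j) ?_
  have h4 (l : Fin k) : (ZMod.val (n := k + 1) (Fin.succ l) : ℤ) = (l : ℕ) + 1 :=
    Nat.cast_succ (l : ℕ)
  have h5 := formJacobi_val c d (k + 1) (Fin.succ (i : Fin k)) (Fin.succ j)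
  rw [h4, h4] at h5
  exact h5.symm

/-! ### Reduction to prime modulus -/

theorem formJacobi_mul (c d : ℤ) {p m : ℕ} [NeZero p] [NeZero m] (h : p.Coprime m)
    (x y : ZMod p × ZMod m) :
    formJacobi c d (p * m) ((ZMod.chineseRemainder h).symm x) ((ZMod.chineseRemainder h).symm y) =
      formJacobi c d p x.1 y.1 * formJacobi c d m x.2 y.2 := by
  have h1 (z : ZMod p × ZMod m) : ZMod.castHom (dvd_mul_right p m) (ZMod p)
      ((ZMod.chineseRemainder h).symm z) = z.1 := by
    have := DFunLike.congr_fun (Subsingleton.elim (ZMod.castHom (dvd_mul_right p m) (ZMod p))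
      ((RingHom.fst _ _).comp (ZMod.chineseRemainder h).toRingHom))
      ((ZMod.chineseRemainder h).symm z)
    simpa using this
  have h2 (z : ZMod p × ZMod m) : ZMod.castHom (dvd_mul_left m p) (ZMod m)
      ((ZMod.chineseRemainder h).symm z) = z.2 := by
    have := DFunLike.congr_fun (Subsingleton.elim (ZMod.castHom (dvd_mul_left m p) (ZMod m))
      ((RingHom.snd _ _).comp (ZMod.chineseRemainder h).toRingHom))
      ((ZMod.chineseRemainder h).symm z)
    simpa using this
  simp only [formJacobi, zmodJacobi_mul, map_add, map_mul, map_pow, map_intCast, h1, h2]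

theorem sum_formJacobi_mul (c d : ℤ) {p m : ℕ} [NeZero p] [NeZero m] (h : p.Coprime m)
    (w : ZMod p → ℤ) (g : ZMod m → ℤ) (i : ZMod (p * m)) :
    ∑ j, formJacobi c d (p * m) i j *
        (w (ZMod.chineseRemainder h j).1 * g (ZMod.chineseRemainder h j).2) =
      (∑ j, formJacobi c d p (ZMod.chineseRemainder h i).1 j * w j) *
        ∑ j, formJacobi c d m (ZMod.chineseRemainder h i).2 j * g j := by
  rw [Finset.sum_mul_sum, ← Fintype.sum_prod_type',
    ← (ZMod.chineseRemainder h).symm.toEquiv.sum_comp]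
  refine Finset.sum_congr rfl fun x _ => ?_
  have := formJacobi_mul c d h (ZMod.chineseRemainder h i) x
  rw [RingEquiv.symm_apply_apply] at this
  simp only [RingEquiv.toEquiv_eq_coe, RingEquiv.coe_toEquiv, this, RingEquiv.apply_symm_apply]
  ring

theorem tensor_ne_zero {p m : ℕ} (h : p.Coprime m) {w : ZMod p → ℤ} {g : ZMod m → ℤ}
    (hw : w ≠ 0) (hg : g ≠ 0) :
    (fun j => w (ZMod.chineseRemainder h j).1 * g (ZMod.chineseRemainder h j).2) ≠ 0 := by
  obtain ⟨a, ha⟩ := Function.ne_iff.mp hw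
  obtain ⟨b, hb⟩ := Function.ne_iff.mp hg
  refine Function.ne_iff.mpr ⟨(ZMod.chineseRemainder h).symm (a, b), ?_⟩
  simpa using ⟨ha, hb⟩

theorem HasNullVector.mul {c d : ℤ} {p m : ℕ} [NeZero p] [NeZero m] (h : p.Coprime m)
    (hp : HasNullVector c d p) : HasNullVector c d (p * m) := by
  obtain ⟨w, h1, h2, h3⟩ := hp
  refine ⟨_, tensor_ne_zero h h1 (g := 1) one_ne_zero, by simp [h2], fun i => ?_⟩
  rw [sum_formJacobi_mul, h3, zero_mul]

/-- For invertible M, column a of the adjugate is sent to a multiple of the basis vector at a. This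
supplies the second tensor factor in `HasMinorNullVector.mul`. -/
theorem exists_mulVec_eq_zero_off {ι : Type*} [Fintype ι] [DecidableEq ι] (M : Matrix ι ι ℤ)
    (a : ι) : ∃ g : ι → ℤ, g ≠ 0 ∧ ∀ i, i ≠ a → M.mulVec g i = 0 := by
  by_cases hM : M.det = 0
  · obtain ⟨g, hg, h⟩ := Matrix.exists_mulVec_eq_zero_iff.mpr hM
    exact ⟨g, hg, fun i _ => by rw [h]; rfl⟩
  · have key : M.mulVec (M.adjugate.mulVec (Pi.single a 1)) = M.det • Pi.single a 1 := by
      rw [Matrix.mulVec_mulVec, Matrix.mul_adjugate, Matrix.smul_mulVec, Matrix.one_mulVec]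
    refine ⟨M.adjugate.mulVec (Pi.single a 1), fun h0 => hM ?_, fun i hi => ?_⟩
    · rw [h0, Matrix.mulVec_zero] at key
      simpa using (congrFun key a).symm
    · rw [key]
      simp [hi]

/-- An index i ≠ 0 modulo p * m may still be 0 modulo p, where w gives no control. It is then
nonzero modulo m, and the factor g is chosen to be killed by all those rows. -/
theorem HasMinorNullVector.mul {c d : ℤ} {p m : ℕ} [NeZero p] [NeZero m] (h : p.Coprime m)
    (hp : HasMinorNullVector c d p) : HasMinorNullVector c d (p * m) := by
  obtain ⟨w, h1, h2, h3⟩ := hp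
  obtain ⟨g, hg, hg'⟩ := exists_mulVec_eq_zero_off (Matrix.of (formJacobi c d m)) 0
  refine ⟨_, tensor_ne_zero h h1 hg, by simp [h2], fun i hi => ?_⟩
  rw [sum_formJacobi_mul]
  by_cases hi1 : (ZMod.chineseRemainder h i).1 = 0
  · have hi2 : (ZMod.chineseRemainder h i).2 ≠ 0 := fun h0 =>
      hi ((map_eq_zero_iff _ (ZMod.chineseRemainder h).injective).mp (Prod.ext hi1 h0))
    exact mul_eq_zero_of_right _ (hg' _ hi2)
  · rw [h3 _ hi1, zero_mul]

/-- The symbol modulo p * m is the product of the symbols modulo p and m, so when p ∣ m it depends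
only on residues modulo m. Hence columns 1 and 1 + m agree. -/
theorem hasNullVector_of_sq_dvd (c d : ℤ) {p m : ℕ} [NeZero p] [NeZero m] (hp : 1 < p)
    (hpm : p ∣ m) : HasNullVector c d (p * m) := by
  have hm : 0 < m := Nat.pos_of_ne_zero (NeZero.ne m)
  have hpm' : p ≤ m := Nat.le_of_dvd hm hpm
  have h0 : (m : ZMod (p * m)) ≠ 0 := by
    rw [Ne, ZMod.natCast_eq_zero_iff]
    exact fun h => absurd (Nat.le_of_dvd hm h) (by nlinarith)
  have h1 : (1 : ZMod (p * m)) ≠ 0 := by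
    have : ((1 : ℕ) : ZMod (p * m)) ≠ 0 := by
      rw [Ne, ZMod.natCast_eq_zero_iff]
      exact fun h => absurd (Nat.le_of_dvd one_pos h) (by nlinarith)
    simpa using this
  have h2 : (1 + m : ZMod (p * m)) ≠ 0 := by
    have : ((1 + m : ℕ) : ZMod (p * m)) ≠ 0 := by
      rw [Ne, ZMod.natCast_eq_zero_iff]
      exact fun h => absurd (Nat.le_of_dvd (by omega) h) (by nlinarith)
    simpa using this
  have h12 : (1 : ZMod (p * m)) ≠ 1 + m := fun h => h0 (by simpa using h)
  have hmp : (m : ZMod p) = 0 := (ZMod.natCast_eq_zero_iff _ _).mpr hpm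
  refine ⟨Pi.single (1 : ZMod (p * m)) (1 : ℤ) - Pi.single (1 + m : ZMod (p * m)) (1 : ℤ), fun h => ?_, ?_, fun i => ?_⟩
  · have := congrFun h 1
    simp [h12] at this
  · simp [h1.symm, h2.symm]
  · simp only [Pi.sub_apply, mul_sub, Finset.sum_sub_distrib, Pi.single_apply, mul_ite, mul_one,
      mul_zero, Finset.sum_ite_eq', Finset.mem_univ, if_true, formJacobi, zmodJacobi_mul,
      map_add, map_mul, map_pow, map_intCast, map_natCast, map_one, hmp, ZMod.natCast_self,
      add_zero, sub_self]

theorem exists_prime_three_mod_four_dvd {n : ℕ} (hn : n % 4 = 3) :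
    ∃ p, p.Prime ∧ p % 4 = 3 ∧ p ∣ n := by
  induction n using Nat.strong_induction_on with
  | _ n ih =>
    have hp : (n.minFac).Prime := Nat.minFac_prime (by omega)
    obtain ⟨m, hm⟩ := n.minFac_dvd
    by_cases h3 : n.minFac % 4 = 3
    · exact ⟨_, hp, h3, n.minFac_dvd⟩
    have key : n % 4 = (n.minFac % 4) * (m % 4) % 4 := by
      conv_lhs => rw [hm]
      rw [Nat.mul_mod]
    have hm3 : m % 4 = 3 := by
      have h4 := Nat.mod_lt n.minFac (show 4 > 0 by norm_num)
      have h5 := Nat.mod_lt m (show 4 > 0 by norm_num)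
      generalize n.minFac % 4 = a at *
      generalize m % 4 = b at *
      interval_cases a <;> omega
    obtain ⟨q, hq, hq3, hqm⟩ := ih m (by
      have := hp.two_le
      nlinarith [show 0 < m by omega]) hm3
    exact ⟨q, hq, hq3, hqm.trans ⟨n.minFac, by rw [mul_comm]; exact hm⟩⟩

/-! ### Null vectors modulo a prime and cubic character sums -/

/-- The character sum of the cubic `x * (x ^ 2 + c * x + d)`. -/
def cubicCharSum (p : ℕ) [Fact p.Prime] (c d : ZMod p) : ℤ :=
  ∑ x : ZMod p, quadraticChar (ZMod p) (x * (x ^ 2 + c * x + d))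

theorem ringChar_ne_two_of_three_mod_four {p : ℕ} (hp : p % 4 = 3) : ringChar (ZMod p) ≠ 2 := by
  rw [ZMod.ringChar_zmod_n]
  omega

theorem quadraticChar_neg_one_of_three_mod_four {p : ℕ} [Fact p.Prime] (hp : p % 4 = 3) :
    quadraticChar (ZMod p) (-1) = -1 := by
  rw [quadraticChar_neg_one (ringChar_ne_two_of_three_mod_four hp), ZMod.card]
  exact ZMod.χ₄_nat_three_mod_four hp

theorem quadraticChar_sq_mul {F : Type*} [Field F] [Fintype F] [DecidableEq F] {a : F}
    (ha : a ≠ 0) (b : F) : quadraticChar F (a ^ 2 * b) = quadraticChar F b := by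
  rw [map_mul, quadraticChar_sq_one' ha, one_mul]

theorem hasNullVector_of_cubicCharSum_eq_zero {p : ℕ} [Fact p.Prime] (hp : p ≠ 2) (c d : ℤ)
    (h : cubicCharSum p c d = 0) : HasNullVector c d p := by
  have hχ : ringChar (ZMod p) ≠ 2 := by rwa [ZMod.ringChar_zmod_n]
  refine ⟨fun j => quadraticChar (ZMod p) j, fun h0 => ?_, by simp, fun i => ?_⟩
  · have := congrFun h0 1
    simp at this
  simp only [formJacobi, zmodJacobi_prime, ← map_mul]
  by_cases hi : i = 0
  · subst hi
    have : ∀ j : ZMod p, quadraticChar (ZMod p) ((0 ^ 2 + c * 0 * j + d * j ^ 2) * j) =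
        quadraticChar (ZMod p) d * quadraticChar (ZMod p) j := by
      intro j
      by_cases hj : j = 0
      · simp [hj]
      · rw [← map_mul, ← quadraticChar_sq_mul hj (d * j)]
        congr 1
        ring
    simp only [this]
    rw [← Finset.mul_sum, quadraticChar_sum_zero hχ, mul_zero]
  -- Substitute j = i / t. With the convention 0⁻¹ = 0 this permutes all of `ZMod p`, and the
  -- summand at 0 is 0.
  · rw [← Equiv.sum_comp ((Equiv.inv (ZMod p)).trans (Equiv.mulLeft₀ i hi))]
    have : ∀ t : ZMod p, quadraticChar (ZMod p) ((i ^ 2 + c * i * (i * t⁻¹) + d * (i * t⁻¹) ^ 2) *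
        (i * t⁻¹)) =
        quadraticChar (ZMod p) i * quadraticChar (ZMod p) (t * (t ^ 2 + c * t + d)) := by
      intro t
      by_cases ht : t = 0
      · simp [ht]
      · rw [← map_mul, ← quadraticChar_sq_mul (div_ne_zero hi (pow_ne_zero 2 ht))
          (i * (t * (t ^ 2 + c * t + d)))]
        congr 1
        field_simp
    simp only [Equiv.trans_apply, Equiv.inv_apply, Equiv.mulLeft₀_apply, this, ← Finset.mul_sum]
    rw [← cubicCharSum, h, mul_zero]

/-- For i ≠ 0 the substitution j = i² / (d t) multiplies the form by d up to a nonzero square, so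
the sum over j ≠ 0 equals its own negative. Row 0 has no such symmetry, so only the minor is
covered. -/
theorem hasMinorNullVector_of_quadraticChar_eq_neg_one {p : ℕ} [Fact p.Prime] (c d : ℤ)
    (h : quadraticChar (ZMod p) d = -1) : HasMinorNullVector c d p := by
  refine ⟨fun j => if j = 0 then 0 else 1, fun h0 => ?_, by simp, fun i hi => ?_⟩
  · have := congrFun h0 1
    simp at this
  have hd : (d : ZMod p) ≠ 0 := fun h0 => by simp [h0] at h
  simp only [formJacobi, zmodJacobi_prime]
  set T := ∑ j : ZMod p, quadraticChar (ZMod p) (i ^ 2 + c * i * j + d * j ^ 2) *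
    (if j = 0 then 0 else 1) with hT
  have key : T = -T := by
    conv_lhs => rw [hT, ← Equiv.sum_comp ((Equiv.inv (ZMod p)).trans (Equiv.mulLeft₀
      (i ^ 2 / (d : ZMod p)) (div_ne_zero (pow_ne_zero 2 hi) hd)))]
    rw [hT, ← Finset.sum_neg_distrib]
    refine Finset.sum_congr rfl fun t _ => ?_
    by_cases ht : t = 0
    · simp [ht]
    · simp only [Equiv.trans_apply, Equiv.inv_apply, Equiv.mulLeft₀_apply]
      rw [if_neg (mul_ne_zero (div_ne_zero (pow_ne_zero 2 hi) hd) (inv_ne_zero ht)), if_neg ht,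
        mul_one, mul_one, neg_eq_neg_one_mul, ← h, ← map_mul,
        ← quadraticChar_sq_mul (div_ne_zero hi (mul_ne_zero hd ht)) (d * _)]
      congr 1
      field_simp
      ring
  omega

theorem cubicCharSum_scale {p : ℕ} [Fact p.Prime] {k : ZMod p} (hk : k ≠ 0) (c d : ZMod p) :
    cubicCharSum p (k * c) (k ^ 2 * d) = quadraticChar (ZMod p) k * cubicCharSum p c d := by
  rw [cubicCharSum, cubicCharSum, Finset.mul_sum, ← Equiv.sum_comp (Equiv.mulLeft₀ k hk)]
  refine Finset.sum_congr rfl fun x _ => ?_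
  rw [← map_mul, ← quadraticChar_sq_mul hk (k * _)]
  congr 1
  simp only [Equiv.mulLeft₀_apply]
  ring

theorem card_add_div_eq {p : ℕ} [Fact p.Prime] (hp : p ≠ 2) (t d : ZMod p) :
    ∑ x : ZMod p, (if x ^ 2 - t * x + d = 0 then (1 : ℤ) else 0) =
      quadraticChar (ZMod p) (t ^ 2 - 4 * d) + 1 := by
  have hχ : ringChar (ZMod p) ≠ 2 := by rwa [ZMod.ringChar_zmod_n]
  have h2 : (2 : ZMod p) ≠ 0 := Ring.two_ne_zero hχ
  rw [← quadraticChar_card_sqrts hχ, Finset.sum_boole, Nat.cast_inj]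
  refine Finset.card_bij (fun x _ => 2 * x - t) (fun x hx => ?_) (fun x _ y _ hxy => ?_)
    fun y hy => ⟨(y + t) / 2, ?_, ?_⟩
  · simp only [Finset.mem_filter, Finset.mem_univ, true_and, Set.mem_toFinset,
      Set.mem_ofPred_eq] at hx ⊢
    linear_combination 4 * hx
  · exact mul_left_cancel₀ h2 (sub_left_injective hxy)
  · simp only [Finset.mem_filter, Finset.mem_univ, true_and, Set.mem_toFinset,
      Set.mem_ofPred_eq] at hy ⊢
    field_simp
    linear_combination hy
  · field_simp
    ring

/-- This is the 2-isogeny with kernel generated by (0, 0), in terms of t = x + d / x: for x ≠ 0 the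
summand is χ(t + c), and t has χ(t² - 4d) + 1 preimages. The condition d ≠ 0 excludes x = 0 from the
fibres. -/
theorem cubicCharSum_isogeny {p : ℕ} [Fact p.Prime] (hp : p ≠ 2) (c : ZMod p) {d : ZMod p}
    (hd : d ≠ 0) : cubicCharSum p c d = cubicCharSum p (-2 * c) (c ^ 2 - 4 * d) := by
  have hχ : ringChar (ZMod p) ≠ 2 := by rwa [ZMod.ringChar_zmod_n]
  have h1 : ∀ x : ZMod p, quadraticChar (ZMod p) (x * (x ^ 2 + c * x + d)) =
      ∑ t : ZMod p, (if x ^ 2 - t * x + d = 0 then (1 : ℤ) else 0) *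
        quadraticChar (ZMod p) (t + c) := by
    intro x
    by_cases hx : x = 0
    · simp [hx, hd]
    · rw [Finset.sum_eq_single (x + d / x)]
      · rw [if_pos (by field_simp; ring), one_mul, ← quadraticChar_sq_mul hx (x + d / x + c)]
        congr 1
        field_simp
        ring
      · intro t _ ht
        rw [if_neg, zero_mul]
        intro h0
        apply ht
        field_simp
        linear_combination -h0
      · simp
  rw [cubicCharSum, Finset.sum_congr rfl fun x _ => h1 x, Finset.sum_comm]
  simp only [← Finset.sum_mul, card_add_div_eq hp, add_mul, one_mul, Finset.sum_add_distrib,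
    ← map_mul]
  have h2 : ∑ t : ZMod p, quadraticChar (ZMod p) (t + c) = 0 := by
    rw [← quadraticChar_sum_zero hχ]
    exact Equiv.sum_comp (Equiv.addRight c) fun t => quadraticChar (ZMod p) t
  rw [h2, add_zero, cubicCharSum]
  conv_rhs => rw [← Equiv.sum_comp (Equiv.addRight c)]
  refine Finset.sum_congr rfl fun t _ => ?_
  congr 1
  simp only [Equiv.coe_addRight]
  ring

theorem two_ne_zero_of_three_mod_four {p : ℕ} [Fact p.Prime] (hp : p % 4 = 3) :
    (2 : ZMod p) ≠ 0 :=
  Ring.two_ne_zero (ringChar_ne_two_of_three_mod_four hp)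

theorem cubicCharSum_neg {p : ℕ} [Fact p.Prime] (hp : p % 4 = 3) (c d : ZMod p) :
    cubicCharSum p (-c) d = -cubicCharSum p c d := by
  have := cubicCharSum_scale (p := p) (neg_ne_zero.mpr one_ne_zero) c d
  rw [quadraticChar_neg_one_of_three_mod_four hp] at this
  simpa using this

theorem cubicCharSum_zero_left {p : ℕ} [Fact p.Prime] (hp : p % 4 = 3) (d : ZMod p) :
    cubicCharSum p 0 d = 0 := by
  have h := cubicCharSum_neg hp 0 d
  rw [neg_zero] at h
  omega

/-- Shifting x by -1 turns the cubic into the odd polynomial x³ - x, and χ(-1) = -1. -/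
theorem cubicCharSum_three_two {p : ℕ} [Fact p.Prime] (hp : p % 4 = 3) :
    cubicCharSum p 3 2 = 0 := by
  have h1 : cubicCharSum p 3 2 = cubicCharSum p 0 (-1) := by
    rw [cubicCharSum, cubicCharSum, ← Equiv.sum_comp (Equiv.addRight (-1 : ZMod p))]
    refine Finset.sum_congr rfl fun t _ => ?_
    congr 1
    simp only [Equiv.coe_addRight]
    ring
  rw [h1, cubicCharSum_zero_left hp]

theorem cubicCharSum_six_one {p : ℕ} [Fact p.Prime] (hp : p % 4 = 3) :
    cubicCharSum p 6 1 = 0 := by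
  have h1 := cubicCharSum_isogeny (p := p) (by omega) 3 (two_ne_zero_of_three_mod_four hp)
  rw [cubicCharSum_three_two hp, show (-2 * 3 : ZMod p) = -6 by norm_num,
    show (3 ^ 2 - 4 * 2 : ZMod p) = 1 by norm_num, cubicCharSum_neg hp] at h1
  omega

/-- The isogenous curve (-8, 8) is the twist of (4, 2) by -2, so the sum S satisfies S = χ(-2) S =
-S. -/
theorem cubicCharSum_four_two {p : ℕ} [Fact p.Prime] (hp : p % 4 = 3)
    (h2 : quadraticChar (ZMod p) 2 = 1) : cubicCharSum p 4 2 = 0 := by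
  have h20 := two_ne_zero_of_three_mod_four hp
  have h1 := cubicCharSum_isogeny (p := p) (by omega) 4 h20
  have h3 := cubicCharSum_scale h20 4 2
  rw [show (-2 * 4 : ZMod p) = -(2 * 4) by norm_num,
    show (4 ^ 2 - 4 * 2 : ZMod p) = 2 ^ 2 * 2 by norm_num, cubicCharSum_neg hp, h3, h2] at h1
  omega

theorem cubicCharSum_eight_eight {p : ℕ} [Fact p.Prime] (hp : p % 4 = 3)
    (h2 : quadraticChar (ZMod p) 2 = 1) : cubicCharSum p 8 8 = 0 := by
  have h3 := cubicCharSum_scale (two_ne_zero_of_three_mod_four hp) 4 2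
  rw [cubicCharSum_four_two hp h2, mul_zero] at h3
  rw [← h3]
  norm_num

/-- The cubic is (x + 1)³ - 1, a permutation of `ZMod p` because cubing is bijective for p ≡ 2 mod
3. -/
theorem cubicCharSum_three_three {p : ℕ} [Fact p.Prime] (hp : p % 4 = 3) (hp3 : p % 3 = 2) :
    cubicCharSum p 3 3 = 0 := by
  have hχ := ringChar_ne_two_of_three_mod_four hp
  have hinj : Function.Injective fun x : ZMod p => x ^ 3 := by
    -- Since p ≡ 2 mod 3, the number (2p - 1) / 3 is an integer, and x ^ (2p - 1) = x.
    have hl : Function.LeftInverse (fun x : ZMod p => x ^ ((2 * p - 1) / 3))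
        (fun x : ZMod p => x ^ 3) := by
      intro x
      have hx := ZMod.pow_card x
      have hx' : x ^ (p - 1) * x = x := by
        rw [← pow_succ, show p - 1 + 1 = p by omega, hx]
      change (x ^ 3) ^ ((2 * p - 1) / 3) = x
      rw [← pow_mul, show 3 * ((2 * p - 1) / 3) = p + (p - 1) by omega, pow_add, hx, mul_comm, hx']
    exact hl.injective
  have hbij := Finite.injective_iff_bijective.mp hinj
  rw [cubicCharSum, ← quadraticChar_sum_zero hχ,
    ← Equiv.sum_comp (((Equiv.addRight (1 : ZMod p)).trans (Equiv.ofBijective _ hbij)).trans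
      (Equiv.addRight (-1))) fun x => quadraticChar (ZMod p) x]
  refine Finset.sum_congr rfl fun t _ => ?_
  congr 1
  simp only [Equiv.trans_apply, Equiv.coe_addRight, Equiv.ofBijective_apply]
  ring

/-! ### The Hasse invariant: scaling, isogeny and translation -/

section HasseInvariant

open Polynomial

/-- The coefficient of `X ^ m` in `(X ^ 2 + c * X + d) ^ m`. For `p = 2 * m + 1` this is the Hasse
invariant of the curve `y ^ 2 = x * (x ^ 2 + c * x + d)` in characteristic `p`. -/
noncomputable def hasseCoeff {R : Type*} [CommRing R] (m : ℕ) (c d : R) : R :=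
  ((X ^ 2 + C c * X + C d) ^ m).coeff m

theorem map_hasseCoeff {R S : Type*} [CommRing R] [CommRing S] (f : R →+* S) (m : ℕ) (c d : R) :
    f (hasseCoeff m c d) = hasseCoeff m (f c) (f d) := by
  rw [hasseCoeff, hasseCoeff, ← coeff_map]
  simp

theorem hasseCoeff_scale {K : Type*} [Field K] (m : ℕ) {k : K} (hk : k ≠ 0) (c d : K) :
    hasseCoeff m (k * c) (k ^ 2 * d) = k ^ m * hasseCoeff m c d := by
  have h : ((X ^ 2 + C (k * c) * X + C (k ^ 2 * d)) ^ m).comp (C k * X) =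
      C (k ^ (2 * m)) * (X ^ 2 + C c * X + C d) ^ m := by
    rw [pow_comp, pow_mul, C_pow, ← mul_pow]
    congr 1
    simp only [add_comp, mul_comp, pow_comp, X_comp, C_comp, C_mul, C_pow]
    ring
  have h' := congrArg (fun q => coeff q m) h
  simp only [comp_C_mul_X_coeff, coeff_C_mul] at h'
  apply mul_right_cancel₀ (pow_ne_zero m hk)
  rw [hasseCoeff, hasseCoeff, h', two_mul, pow_add]
  ring

theorem hasseCoeff_eq_coeff_cubic {R : Type*} [CommRing R] (m : ℕ) (c d : R) :
    hasseCoeff m c d = ((X * (X ^ 2 + C c * X + C d)) ^ m).coeff (2 * m) := by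
  rw [mul_pow, two_mul, coeff_X_pow_mul, hasseCoeff]

theorem natDegree_cubic_pow_le {R : Type*} [CommRing R] (m : ℕ) (c d : R) :
    ((X * (X ^ 2 + C c * X + C d)) ^ m).natDegree ≤ 3 * m := by
  rw [mul_comm 3]
  refine natDegree_pow_le_of_le m ?_
  compute_degree

theorem sum_pow_card_sub_one (p : ℕ) [Fact p.Prime] : ∑ x : ZMod p, x ^ (p - 1) = -1 := by
  have h : ∀ x : ZMod p, x ^ (p - 1) = 1 - if x = 0 then 1 else 0 := by
    intro x
    have := (Fact.out : p.Prime).two_le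
    by_cases hx : x = 0
    · simp [hx, show p - 1 ≠ 0 by omega]
    · simp [hx, ZMod.pow_card_sub_one_eq_one hx]
  simp [h]

/-- Among exponents below 2 (p - 1), only p - 1 has a nonzero power sum over `ZMod p`. -/
theorem sum_eval_eq_neg_coeff {p : ℕ} [Fact p.Prime] {g : (ZMod p)[X]}
    (hg : g.natDegree < 2 * (p - 1)) : ∑ x, g.eval x = -g.coeff (p - 1) := by
  have hp := (Fact.out : p.Prime).two_le
  simp only [eval_eq_sum_range' hg]
  rw [Finset.sum_comm]
  simp only [← Finset.mul_sum]
  rw [Finset.sum_eq_single (p - 1), sum_pow_card_sub_one, mul_neg_one]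
  · intro i hi hne
    rw [Finset.mem_range] at hi
    rcases lt_or_gt_of_ne hne with h | h
    · rw [FiniteField.sum_pow_lt_card_sub_one _ _ (by rwa [ZMod.card]), mul_zero]
    · have : ∀ x : ZMod p, x ^ i = x ^ (i - (p - 1)) := fun x => by
        conv_lhs => rw [show i = p + (i - p) by omega, pow_add, ZMod.pow_card, ← pow_succ']
        congr 1
        omega
      simp only [this]
      rw [FiniteField.sum_pow_lt_card_sub_one _ _ (by rw [ZMod.card]; omega), mul_zero]
  · intro h
    exact absurd (Finset.mem_range.mpr (by omega)) h

theorem cubicCharSum_cast {p m : ℕ} [Fact p.Prime] (hm : p = 2 * m + 1) (hm0 : 0 < m)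
    (c d : ZMod p) : (cubicCharSum p c d : ZMod p) = -hasseCoeff m c d := by
  have hχ : ringChar (ZMod p) ≠ 2 := by
    rw [ZMod.ringChar_zmod_n]
    omega
  have h1 : ∀ x : ZMod p, ((quadraticChar (ZMod p) (x * (x ^ 2 + c * x + d)) : ℤ) : ZMod p) =
      ((X * (X ^ 2 + C c * X + C d)) ^ m).eval x := by
    intro x
    rw [quadraticChar_eq_pow_of_char_ne_two' hχ, ZMod.card, show p / 2 = m by omega]
    simp
  rw [cubicCharSum, Int.cast_sum, Finset.sum_congr rfl fun x _ => h1 x, sum_eval_eq_neg_coeff,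
    hasseCoeff_eq_coeff_cubic, show p - 1 = 2 * m by omega]
  have := natDegree_cubic_pow_le m c d
  omega

theorem natDegree_coeff_pow_le {R : Type*} [CommRing R] {a b : R[X]} (ha : a.natDegree ≤ 1)
    (hb : b.natDegree ≤ 1) (m n : ℕ) :
    (((X ^ 2 + C a * X + C b : R[X][X]) ^ m).coeff n).natDegree ≤ m := by
  induction m generalizing n with
  | zero =>
    rw [pow_zero, coeff_one]
    split_ifs <;> simp
  | succ m ih =>
    rw [pow_succ, coeff_mul]
    refine natDegree_sum_le_of_forall_le _ _ fun x _ => natDegree_mul_le_of_le (ih _) ?_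
    rw [coeff_add, coeff_add, coeff_X_pow, coeff_C_mul_X, coeff_C]
    refine (natDegree_add_le_of_degree_le (natDegree_add_le_of_degree_le (n := 1) ?_ ?_) ?_) <;>
    split_ifs <;> simp [ha, hb]

/-- Both sides have degree at most m < p - 1 in the variable d, and the character sum identity makes
them agree at the p - 1 nonzero residues. This frees the isogeny relation from the prime field. -/
theorem hasseCoeff_isogeny_poly {p m : ℕ} [Fact p.Prime] (hm : p = 2 * m + 1) (hm0 : 0 < m) :
    (hasseCoeff m 1 X : (ZMod p)[X]) = hasseCoeff m (-2) (1 - 4 * X) := by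
  rw [← sub_eq_zero]
  refine eq_zero_of_natDegree_lt_card_of_eval_eq_zero' _ (Finset.univ.erase (0 : ZMod p))
    (fun d hd => ?_) ?_
  · have h := cubicCharSum_isogeny (p := p) (by omega) 1 (Finset.ne_of_mem_erase hd)
    have h' := congrArg (Int.cast : ℤ → ZMod p) h
    rw [cubicCharSum_cast hm hm0, cubicCharSum_cast hm hm0, neg_inj] at h'
    rw [eval_sub, sub_eq_zero, ← coe_evalRingHom, map_hasseCoeff, map_hasseCoeff]
    simpa using h'
  · rw [Finset.card_erase_of_mem (Finset.mem_univ _), Finset.card_univ, ZMod.card]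
    refine lt_of_le_of_lt ((natDegree_sub_le_of_le (m := m) (n := m) ?_ ?_).trans_eq
      (max_self m)) (show m < p - 1 by omega)
    · exact natDegree_coeff_pow_le (by simp) (by simp) m m
    · exact natDegree_coeff_pow_le (by compute_degree; norm_num) (by compute_degree) m m

theorem hasseCoeff_isogeny {p m : ℕ} [Fact p.Prime] (hm : p = 2 * m + 1) (hm0 : 0 < m)
    {K : Type*} [Field K] [Algebra (ZMod p) K] {c : K} (hc : c ≠ 0) (d : K) :
    hasseCoeff m c d = hasseCoeff m (-2 * c) (c ^ 2 - 4 * d) := by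
  have h := congrArg (aeval (d / c ^ 2) : (ZMod p)[X] →ₐ[ZMod p] K).toRingHom
    (hasseCoeff_isogeny_poly hm hm0)
  rw [map_hasseCoeff, map_hasseCoeff] at h
  simp only [AlgHom.toRingHom_eq_coe, RingHom.coe_coe, map_one, aeval_X, map_neg, map_sub, map_mul,
    map_ofNat] at h
  have h' := congrArg (c ^ m * ·) h
  simp only [← hasseCoeff_scale m hc] at h'
  convert h' using 2 <;> field_simp

/-- Terms of degree i with p ≤ i ≤ 2p - 2 contribute multiples of the binomial coefficient C(i, p -
1), which p divides. -/
theorem coeff_comp_X_add_C_of_natDegree_lt {p : ℕ} [Fact p.Prime] {K : Type*} [CommRing K]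
    [CharP K p] {g : K[X]} (hg : g.natDegree < 2 * p - 1) (r : K) :
    (g.comp (X + C r)).coeff (p - 1) = g.coeff (p - 1) := by
  have hp := (Fact.out : p.Prime).two_le
  rw [← taylor_apply, taylor_coeff, hasseDeriv_apply, sum_over_range' _ (by simp) _ hg,
    eval_finsetSum, Finset.sum_eq_single (p - 1)]
  · simp
  · intro i hi hne
    rw [Finset.mem_range] at hi
    rcases lt_or_gt_of_ne hne with h | h
    · simp [Nat.choose_eq_zero_of_lt h]
    · have hdvd : p ∣ i.choose (p - 1) := by
        have := (Fact.out : p.Prime).dvd_choose_add (a := p - 1) (b := i - (p - 1))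
          (by omega) (by omega) (by omega)
        rwa [Nat.add_sub_cancel' h.le] at this
      simp [(CharP.cast_eq_zero_iff K p _).mpr hdvd]
  · intro h
    exact absurd (Finset.mem_range.mpr (by omega)) h

/-- Moving the root r of the quadratic to the origin changes which 2-torsion point is distinguished,
not the Hasse invariant. -/
theorem hasseCoeff_translate {p m : ℕ} [Fact p.Prime] (hm : p = 2 * m + 1)
    {K : Type*} [Field K] [CharP K p] {c d c' d' r : K} (hc : c' = 3 * r + c)
    (hd : d' = 3 * r ^ 2 + 2 * c * r + d) (hr : r ^ 2 + c * r + d = 0) :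
    hasseCoeff m c' d' = hasseCoeff m c d := by
  rw [hasseCoeff_eq_coeff_cubic, hasseCoeff_eq_coeff_cubic, show 2 * m = p - 1 by omega,
    ← coeff_comp_X_add_C_of_natDegree_lt (p := p)
      (g := (X * (X ^ 2 + C c * X + C d)) ^ m) _ r]
  · congr 1
    rw [pow_comp]
    congr 1
    have h := congrArg C hr
    simp only [C_add, C_mul, C_pow, C_0] at h
    simp only [mul_comp, add_comp, pow_comp, X_comp, C_comp, hc, hd, C_add, C_mul, C_pow, C_ofNat]
    linear_combination (-C r) * h
  · have := natDegree_cubic_pow_le m c d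
    omega

end HasseInvariant

/-! ### Vanishing of the Hasse invariant for (21, 112) -/

theorem abs_cubicCharSum_lt (p : ℕ) [Fact p.Prime] (c d : ZMod p) : |cubicCharSum p c d| < p := by
  have hp := (Fact.out : p.Prime).two_le
  rw [cubicCharSum, ← Finset.sum_erase Finset.univ (a := (0 : ZMod p)) (by simp)]
  refine lt_of_le_of_lt (Finset.abs_sum_le_sum_abs _ _)
    (lt_of_le_of_lt (Finset.sum_le_card_nsmul _ _ 1 fun x _ => ?_) ?_)
  · rcases quadraticChar_isQuadratic (ZMod p) (x * (x ^ 2 + c * x + d)) with h | h | h <;>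
      simp [h]
  · rw [Finset.card_erase_of_mem (Finset.mem_univ _), Finset.card_univ, ZMod.card, nsmul_one]
    exact_mod_cast (by omega : p - 1 < p)

theorem cubicCharSum_eq_zero_of_hasseCoeff {p m : ℕ} [Fact p.Prime] (hm : p = 2 * m + 1)
    (hm0 : 0 < m) {c d : ZMod p} (h : hasseCoeff m c d = 0) : cubicCharSum p c d = 0 := by
  have h1 := cubicCharSum_cast hm hm0 c d
  rw [h, neg_zero, ZMod.intCast_zmod_eq_zero_iff_dvd] at h1
  exact Int.eq_zero_of_abs_lt_dvd h1 (abs_cubicCharSum_lt p c d)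

/-- The quadratic has discriminant -7, hence roots (-21 ± s) / 2. Moving either one to the origin
preserves the invariant H, and the 2-isogeny carries one resulting curve to the other scaled by α²,
where α = (1 + s) / 2 has norm 2. Thus H = α ^ (2m) H, while α ^ (2m) ≠ 1. -/
theorem hasseCoeff_twentyone_of_sq_eq {p m : ℕ} [Fact p.Prime] (hm : p = 2 * m + 1) (hm0 : 0 < m)
    (hp3 : p ≠ 3) (hp7 : p ≠ 7) {K : Type*} [Field K] [Algebra (ZMod p) K] [CharP K p] {s : K}
    (hs : s ^ 2 = -7) (hsp : s ^ p = -s) : hasseCoeff m (21 : K) 112 = 0 := by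
  have hpr : p.Prime := Fact.out
  have hprime (q : ℕ) (hq : q.Prime) (hqp : p ≠ q) : (q : K) ≠ 0 := by
    rw [Ne, CharP.cast_eq_zero_iff K p, Nat.prime_dvd_prime_iff_eq hpr hq]
    exact hqp
  have h2 : (2 : K) ≠ 0 := by exact_mod_cast hprime 2 Nat.prime_two (by omega)
  have h3 : (3 : K) ≠ 0 := by exact_mod_cast hprime 3 Nat.prime_three hp3
  have h70 : (7 : K) ≠ 0 := by exact_mod_cast hprime 7 (by norm_num) hp7
  have hs0 : s ≠ 0 := by
    rintro rfl
    apply h70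
    linear_combination hs
  set α : K := (1 + s) / 2 with hα
  have hα0 : α ≠ 0 := by
    intro h
    have h1 : s = -1 := by
      rw [hα, div_eq_zero_iff, or_iff_left h2] at h
      linear_combination h
    rw [h1] at hs
    apply pow_ne_zero 3 h2
    linear_combination hs
  have hαp : α ^ p = (1 - s) / 2 := by
    have h2p : (2 : K) ^ p = 2 := by
      have := congrArg (algebraMap (ZMod p) K) (ZMod.pow_card (2 : ZMod p))
      simpa only [map_pow, map_ofNat] using this
    rw [hα, div_pow, add_pow_char, one_pow, hsp, h2p, sub_eq_add_neg]
  -- Since 2m = p - 1, equality would give α ^ p = α, but Frobenius sends α to its conjugate (1 - s)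
  -- / 2.
  have hαm : (α ^ 2) ^ m ≠ 1 := by
    intro h
    have h1 : α ^ (2 * m + 1) = α := by rw [pow_succ, pow_mul, h, one_mul]
    rw [← hm, hαp, hα] at h1
    field_simp at h1
    exact mul_ne_zero h2 hs0 (by linear_combination -h1)
  have e1 : hasseCoeff m ((-21 + 3 * s) / 2) ((-21 * s - 7) / 2) = hasseCoeff m (21 : K) 112 := by
    refine hasseCoeff_translate (p := p) (r := (-21 + s) / 2) hm ?_ ?_ ?_
    · field_simp
      ring
    · field_simp
      linear_combination (-3 : K) * hs
    · field_simp
      linear_combination hs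
  have e2 : hasseCoeff m ((-21 - 3 * s) / 2) ((21 * s - 7) / 2) = hasseCoeff m (21 : K) 112 := by
    refine hasseCoeff_translate (p := p) (r := (-21 - s) / 2) hm ?_ ?_ ?_
    · field_simp
      ring
    · field_simp
      linear_combination (-3 : K) * hs
    · field_simp
      linear_combination hs
  have hc : (-21 + 3 * s) / 2 ≠ 0 := by
    intro h
    rw [div_eq_zero_iff, or_iff_left h2] at h
    have h1 : s = 7 := mul_left_cancel₀ h3 (by linear_combination h)
    rw [h1] at hs
    exact mul_ne_zero (pow_ne_zero 3 h2) h70 (by linear_combination hs)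
  have e3 := hasseCoeff_isogeny hm hm0 hc ((-21 * s - 7) / 2)
  have e4 := hasseCoeff_scale m (pow_ne_zero 2 hα0) ((-21 - 3 * s) / 2) ((21 * s - 7) / 2)
  have f1 : -2 * ((-21 + 3 * s) / 2) = α ^ 2 * ((-21 - 3 * s) / 2) := by
    rw [hα]
    field_simp
    linear_combination (27 + 3 * s) * hs
  have f2 : ((-21 + 3 * s) / 2) ^ 2 - 4 * ((-21 * s - 7) / 2) =
      (α ^ 2) ^ 2 * ((21 * s - 7) / 2) := by
    rw [hα]
    field_simp
    linear_combination (-21 * s ^ 3 - 77 * s ^ 2 + 49 * s + 569) * hs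
  rw [f1, f2, e4, e1, e2] at e3
  have : (1 - (α ^ 2) ^ m) * hasseCoeff m (21 : K) 112 = 0 := by linear_combination e3
  exact (mul_eq_zero.mp this).resolve_left (sub_ne_zero.mpr hαm.symm)

theorem hasseCoeff_twentyone {p m : ℕ} [Fact p.Prime] (hm : p = 2 * m + 1) (hm0 : 0 < m)
    (hp3 : p ≠ 3) (hp7 : p ≠ 7) (h7 : quadraticChar (ZMod p) (-7) = -1) :
    hasseCoeff m (21 : ZMod p) 112 = 0 := by
  have hχ : ringChar (ZMod p) ≠ 2 := by
    rw [ZMod.ringChar_zmod_n]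
    omega
  have : CharP (AlgebraicClosure (ZMod p)) p :=
    charP_of_injective_algebraMap (algebraMap (ZMod p) _).injective p
  obtain ⟨s, hs⟩ := IsAlgClosed.exists_pow_nat_eq (-7 : AlgebraicClosure (ZMod p)) two_pos
  have hsp : s ^ p = -s := by
    have h := quadraticChar_eq_pow_of_char_ne_two' hχ (-7)
    rw [h7, ZMod.card, show p / 2 = m by omega] at h
    have h' := congrArg (algebraMap (ZMod p) (AlgebraicClosure (ZMod p))) h
    simp only [Int.cast_neg, Int.cast_one, map_neg, map_one, map_pow, map_ofNat] at h'
    have h1 : s ^ (2 * m + 1) = -s := by rw [pow_succ, pow_mul, hs, ← h', neg_one_mul]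
    rwa [← hm] at h1
  apply (algebraMap (ZMod p) (AlgebraicClosure (ZMod p))).injective
  rw [map_hasseCoeff, map_zero, map_ofNat, map_ofNat]
  exact hasseCoeff_twentyone_of_sq_eq hm hm0 hp3 hp7 hs hsp

theorem cubicCharSum_twentyone {p : ℕ} [Fact p.Prime] (hp : p % 4 = 3) (hp7 : p ≠ 7)
    (h7 : quadraticChar (ZMod p) 7 = 1) : cubicCharSum p 21 112 = 0 := by
  -- Modulo 3 the coefficient 21 is 0, so the cubic is odd.
  by_cases hp3 : p = 3
  · subst hp3
    exact cubicCharSum_zero_left hp 112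
  · refine cubicCharSum_eq_zero_of_hasseCoeff (m := p / 2) (by omega) (by omega)
      (hasseCoeff_twentyone (by omega) (by omega) hp3 hp7 ?_)
    rw [show (-7 : ZMod p) = -1 * 7 by norm_num, map_mul, h7,
      quadraticChar_neg_one_of_three_mod_four hp, mul_one]

/-! ### Assembly from the prime cases -/

theorem sunDet_eq_zero_of_prime {c d : ℤ}
    (h : ∀ p [Fact p.Prime], p % 4 = 3 → HasMinorNullVector c d p) {n : ℕ} (hn : n % 4 = 3) :
    sunDet c d n = 0 := by
  obtain ⟨p, hp, hp3, m, rfl⟩ := exists_prime_three_mod_four_dvd hn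
  have : Fact p.Prime := ⟨hp⟩
  have : NeZero m := ⟨by rintro rfl; simp at hn⟩
  by_cases hpm : p ∣ m
  · exact (hasNullVector_of_sq_dvd c d hp.one_lt hpm).minor.sunDet_eq_zero
  · exact ((h p hp3).mul ((hp.coprime_iff_not_dvd).mpr hpm)).sunDet_eq_zero

theorem sunDetZero_eq_zero_of_prime {c d : ℤ}
    (h : ∀ p [Fact p.Prime], p % 4 = 3 → HasNullVector c d p) {n : ℕ} (hn : n % 4 = 3) :
    sunDetZero c d n = 0 := by
  obtain ⟨p, hp, hp3, m, rfl⟩ := exists_prime_three_mod_four_dvd hn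
  have : Fact p.Prime := ⟨hp⟩
  have : NeZero m := ⟨by rintro rfl; simp at hn⟩
  by_cases hpm : p ∣ m
  · exact (hasNullVector_of_sq_dvd c d hp.one_lt hpm).sunDetZero_eq_zero
  · exact ((h p hp3).mul ((hp.coprime_iff_not_dvd).mpr hpm)).sunDetZero_eq_zero

theorem hasNullVector_three_two {p : ℕ} [Fact p.Prime] (hp : p % 4 = 3) : HasNullVector 3 2 p :=
  hasNullVector_of_cubicCharSum_eq_zero (by omega) 3 2 (by exact_mod_cast cubicCharSum_three_two hp)

theorem hasNullVector_six_one {p : ℕ} [Fact p.Prime] (hp : p % 4 = 3) : HasNullVector 6 1 p :=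
  hasNullVector_of_cubicCharSum_eq_zero (by omega) 6 1 (by exact_mod_cast cubicCharSum_six_one hp)

theorem hasMinorNullVector_four_two {p : ℕ} [Fact p.Prime] (hp : p % 4 = 3) :
    HasMinorNullVector 4 2 p := by
  rcases quadraticChar_dichotomy (two_ne_zero_of_three_mod_four hp) with h | h
  · exact (hasNullVector_of_cubicCharSum_eq_zero (by omega) 4 2
      (by exact_mod_cast cubicCharSum_four_two hp h)).minor
  · exact hasMinorNullVector_of_quadraticChar_eq_neg_one 4 2 (by exact_mod_cast h)

theorem hasMinorNullVector_eight_eight {p : ℕ} [Fact p.Prime] (hp : p % 4 = 3) :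
    HasMinorNullVector 8 8 p := by
  have h2 := two_ne_zero_of_three_mod_four hp
  rcases quadraticChar_dichotomy h2 with h | h
  · exact (hasNullVector_of_cubicCharSum_eq_zero (by omega) 8 8
      (by exact_mod_cast cubicCharSum_eight_eight hp h)).minor
  · refine hasMinorNullVector_of_quadraticChar_eq_neg_one 8 8 ?_
    rw [← h, ← quadraticChar_sq_mul h2 2]
    norm_num

theorem quadraticChar_three_of_mod {p : ℕ} [Fact p.Prime] (hp : p % 4 = 3) (hp3 : p % 3 = 1) :
    quadraticChar (ZMod p) 3 = -1 := by
  have : Fact (Nat.Prime 3) := ⟨Nat.prime_three⟩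
  have h := legendreSym.quadratic_reciprocity_three_mod_four (p := p) (q := 3) hp rfl
  rw [legendreSym.mod 3 p, show (p : ℤ) % (3 : ℕ) = 1 by omega, legendreSym.at_one] at h
  have h' : legendreSym p ((3 : ℕ) : ℤ) = -1 := by omega
  simpa [legendreSym] using h'

theorem hasMinorNullVector_three_three {p : ℕ} [Fact p.Prime] (hp : p % 4 = 3) :
    HasMinorNullVector 3 3 p := by
  by_cases hp1 : p % 3 = 1
  · exact hasMinorNullVector_of_quadraticChar_eq_neg_one 3 3
      (by exact_mod_cast quadraticChar_three_of_mod hp hp1)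
  · refine (hasNullVector_of_cubicCharSum_eq_zero (by omega) 3 3 ?_).minor
    by_cases hp3 : p = 3
    · subst hp3
      exact cubicCharSum_zero_left hp _
    · have : ¬3 ∣ p := fun h =>
        hp3 ((Nat.prime_dvd_prime_iff_eq Nat.prime_three Fact.out).mp h).symm
      exact_mod_cast cubicCharSum_three_three hp (by omega)

theorem hasMinorNullVector_twentyone {p : ℕ} [Fact p.Prime] (hp : p % 4 = 3) :
    HasMinorNullVector 21 112 p := by
  by_cases hp7 : p = 7
  · subst hp7
    refine (hasNullVector_of_cubicCharSum_eq_zero (by omega) 21 112 ?_).minor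
    exact cubicCharSum_zero_left hp _
  have h70 : (7 : ZMod p) ≠ 0 := by
    have : ((7 : ℕ) : ZMod p) ≠ 0 := by
      rw [Ne, ZMod.natCast_eq_zero_iff, Nat.prime_dvd_prime_iff_eq Fact.out (by norm_num)]
      exact hp7
    exact_mod_cast this
  rcases quadraticChar_dichotomy h70 with h | h
  · exact (hasNullVector_of_cubicCharSum_eq_zero (by omega) 21 112
      (by exact_mod_cast cubicCharSum_twentyone hp hp7 h)).minor
  · refine hasMinorNullVector_of_quadraticChar_eq_neg_one 21 112 ?_
    -- Here 112 = (2²)² * 7 has the same character as 7.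
    rw [← h, ← quadraticChar_sq_mul (pow_ne_zero 2 (two_ne_zero_of_three_mod_four hp)) 7]
    norm_num

theorem corollary1p1 (n : ℕ) (hn : n ≡ 3 [MOD 4]) :
    (sunDet 6 1 n = 0 ∧ sunDetZero 6 1 n = 0 ∧ sunDet 3 2 n = 0 ∧ sunDetZero 3 2 n = 0) ∧
    (sunDet 4 2 n = 0 ∧ sunDet 8 8 n = 0 ∧ sunDet 3 3 n = 0 ∧ sunDet 21 112 n = 0) := by
  have hn' : n % 4 = 3 := hn
  exact ⟨⟨sunDet_eq_zero_of_prime (fun _ _ hp => (hasNullVector_six_one hp).minor) hn',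
    sunDetZero_eq_zero_of_prime (fun _ _ hp => hasNullVector_six_one hp) hn',
    sunDet_eq_zero_of_prime (fun _ _ hp => (hasNullVector_three_two hp).minor) hn',
    sunDetZero_eq_zero_of_prime (fun _ _ hp => hasNullVector_three_two hp) hn'⟩,
    sunDet_eq_zero_of_prime (fun _ _ hp => hasMinorNullVector_four_two hp) hn',
    sunDet_eq_zero_of_prime (fun _ _ hp => hasMinorNullVector_eight_eight hp) hn',
    sunDet_eq_zero_of_prime (fun _ _ hp => hasMinorNullVector_three_three hp) hn',
    sunDet_eq_zero_of_prime (fun _ _ hp => hasMinorNullVector_twentyone hp) hn'⟩
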